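/- Let $f$ be a transcendental meromorphic function in $\mathbb{C}$ whose order of growth $\sigma(f)=\limsup_{r\to\infty}\frac{\log T(r,f)}{\log r}$ is finite and not an integer, and let $c\in\mathbb{C}$ be such that $f(z+c)\not\equiv f(z)$. Let $n\ge 1$, $a_0,\dots,a_n\in\mathbb{C}$ with $a_n\neq 0$, and put $L_c^n(f)(z)=\sum_{j=0}^n a_j f(z+jc)$. Let $\mathcal{M}_c$ be the class of meromorphic functions $\pi$ in $\mathbb{C}$ with $\pi(z+c)\equiv\pi(z)$. Suppose that for two distinct $a,b\in\mathbb{C}$ the functions $L_c^n(f)$ and $f$ share the three values $a,b,\infty$ CM (that is, $L^n_c(f)-a$ and $f-a$ have the same zeros with the same multiplicities, likewise for $b$, and $L_c^n(f)$ and $f$ have the same poles with the same multiplicities). Then $L_c^n(f)\equiv f$. Furthermore, consider the equation $$a_nw^n+\cdots+a_1w+a_0-1=0. \qquad (*)$$ Below, $\rho^{z/c}=\exp\!\big(\tfrac{z}{c}\operatorname{Log}\rho\big)$ for $\rho\ne0$, with the principal logarithm, and $0^{z/c}\equiv 0$. **A.** If $(*)$ has $n$ distinct roots $\rho_1,\dots,\rho_n$,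 then there are $\pi_1,\dots,\pi_n\in\mathcal{M}_c$ with $$f(z)=\rho_1^{z/c}\pi_1(z)+\cdots+\rho_n^{z/c}\pi_n(z).$$ In particular, if all $\rho_j\in\{0,1\}$ and at least one $\rho_j$ is non-zero, then $f\in\mathcal{M}_c$ (so that, as $f(z+c)\not\equiv f(z)$, this case does not occur). **B.** In general (in particular when $(*)$ has multiple roots), if $\sigma_1,\dots,\sigma_q$ are the distinct roots of $(*)$, with respective multiplicities $N_1,\dots,N_q$, then there are $\pi_{k,m}\in\mathcal{M}_c$ ($1\le k\le q$, $0\le m\le N_k-1$) with $$f(z)=\sum_{k=1}^{q}\Big(\sum_{m=0}^{N_k-1}z^{m}\pi_{k,m}(z)\Big)\sigma_k^{z/c}.$$ -/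

import Mathlib

open Filter

noncomputable section

/-- Two meromorphic functions are identical (`f ≡ g`) if their values agree off a closed discrete
set; the values that Lean assigns at poles and removable points are irrelevant. -/
def MerEq (f g : ℂ → ℂ) : Prop := f =ᶠ[codiscrete ℂ] g

/-- A meromorphic function is transcendental if it is not a rational function. -/
def IsTranscendentalMer (f : ℂ → ℂ) : Prop :=
  Meromorphic f ∧
    ¬ ∃ p q : Polynomial ℂ, q ≠ 0 ∧ MerEq f (fun z => p.eval z / q.eval z)

/-- The order of growth `limsup_{r → ∞} log T(r, f) / log r`, where `T(r, f)` is the Nevanlinna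
characteristic of `f`. -/
def growthOrder (f : ℂ → ℂ) : EReal :=
  limsup (fun r : ℝ =>
    ((Real.log (ValueDistribution.characteristic f ⊤ r) / Real.log r : ℝ) : EReal)) atTop

/-- The multiplicity of `z` as a zero of `f - v` (zero where `f - v` does not vanish, `⊤` if `f` is
identically `v`). -/
def valueMult (f : ℂ → ℂ) (v : ℂ) (z : ℂ) : WithTop ℤ :=
  max (meromorphicOrderAt (fun w => f w - v) z) 0

/-- The multiplicity of `z` as a pole of `f`, with a minus sign (zero if `z` is not a pole). -/
def negPoleMult (f : ℂ → ℂ) (z : ℂ) : WithTop ℤ :=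
  min (meromorphicOrderAt f z) 0

/-- `f` and `g` share the finite value `v` counting multiplicities. -/
def ShareValueCM (f g : ℂ → ℂ) (v : ℂ) : Prop :=
  ∀ z, valueMult f v z = valueMult g v z

/-- `f` and `g` share `∞` counting multiplicities. -/
def SharePolesCM (f g : ℂ → ℂ) : Prop :=
  ∀ z, negPoleMult f z = negPoleMult g z

/-- The linear difference operator `∑_{j=0}^n a_j f(z + j c)`. -/
def linDiffOp (n : ℕ) (a : ℕ → ℂ) (c : ℂ) (f : ℂ → ℂ) : ℂ → ℂ :=
  fun z => ∑ j ∈ Finset.range (n + 1), a j * f (z + j * c)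

/-- The class of meromorphic functions in the plane with `f(z + c) ≡ f(z)`. -/
def periodicMer (c : ℂ) : Set (ℂ → ℂ) :=
  {f | Meromorphic f ∧ MerEq (fun z => f (z + c)) f}

/-- The polynomial `a_n w^n + ⋯ + a_1 w + a_0 - 1`. -/
def charPoly (n : ℕ) (a : ℕ → ℂ) : Polynomial ℂ :=
  (∑ j ∈ Finset.range (n + 1), Polynomial.C (a j) * Polynomial.X ^ j) - 1

end

noncomputable section

/-! ### Equality of meromorphic functions off a discrete set -/

/-! Write F for `linDiffOp n a c f`. Identity F ≡ f: if T(r,f) = O(r^s), the same holds for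
translates of f (`exists_characteristic_translate_le`), hence for F. Sharing α and ∞ CM makes
(F-α)/(f-α) free of zeros and poles. Its characteristic is O(r^s), so it equals e^P with a
polynomial P of degree at most d = ⌊s⌋ (`exists_exp_polynomial_of_order_eq_zero`). In the same way
F-β = e^Q (f-β). Subtracting gives (e^P - e^Q) f = β - α + α e^P - β e^Q. If e^P ≢ e^Q, then f is a
quotient of combinations of e^P and e^Q, so T(r,f) = O(r^d). Since the order σ is not an integer, s
can be chosen with d < σ < s, a contradiction; when σ < 1 one takes d = 0, and f would be constant
(`merEq_of_share_three_values`). If e^P ≡ e^Q, then α ≠ β forces both to be 1, that is F ≡ f.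

Representation of f: modulo functions vanishing off a discrete set, `charPoly` evaluated at the
translation operator E annihilates f. A Bézout identity splits f into components killed by
(E-σ_k)^{N_k}. Division by σ_k^{z/c} turns E-σ_k into E-1 up to a factor, and solutions of (E-1)^N g
= 0 are polynomials in z with periodic coefficients (`exists_periodic_of_unipotent`). -/

lemma merEq_iff {f g : ℂ → ℂ} : MerEq f g ↔ ∀ x, f =ᶠ[nhdsWithin x {x}ᶜ] g := by
  simp only [MerEq, EventuallyEq, Filter.Eventually, mem_codiscrete, disjoint_principal_right,
    compl_compl]

lemma MerEq.comp_add_const {f g : ℂ → ℂ} (h : MerEq f g) (c : ℂ) :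
    MerEq (fun z => f (z + c)) (fun z => g (z + c)) := by
  rw [merEq_iff] at h ⊢
  intro x
  have ht : Tendsto (fun z : ℂ => z + c) (nhdsWithin x {x}ᶜ) (nhdsWithin (x + c) {x + c}ᶜ) := by
    refine tendsto_nhdsWithin_iff.2 ⟨?_, ?_⟩
    · exact ((continuous_add_const c).tendsto x).mono_left nhdsWithin_le_nhds
    · filter_upwards [self_mem_nhdsWithin] with z hz
      simpa using hz
  exact ht.eventually (h (x + c))

/-- The translation operator `f ↦ f(· + c)`. -/
def shiftEnd (c : ℂ) : Module.End ℂ (ℂ → ℂ) := LinearMap.funLeft ℂ ℂ (· + c)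

@[simp] lemma shiftEnd_apply (c : ℂ) (f : ℂ → ℂ) (z : ℂ) : shiftEnd c f z = f (z + c) := rfl

lemma shiftEnd_pow_apply (c : ℂ) (j : ℕ) (f : ℂ → ℂ) (z : ℂ) :
    (shiftEnd c ^ j) f z = f (z + j * c) := by
  induction j generalizing f with
  | zero => simp
  | succ j ih =>
    rw [pow_succ, Module.End.mul_apply, ih, shiftEnd_apply]
    push_cast
    ring_nf

/-- The functions vanishing off a discrete set. -/
def nullMer : Submodule ℂ (ℂ → ℂ) where
  carrier := {f | MerEq f 0}
  zero_mem' := show (0 : ℂ → ℂ) =ᶠ[codiscrete ℂ] 0 from EventuallyEq.rfl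
  add_mem' {f g} hf hg := by
    have := EventuallyEq.add (show f =ᶠ[codiscrete ℂ] 0 from hf) hg
    rwa [add_zero] at this
  smul_mem' a f hf := by
    have := EventuallyEq.const_smul (show f =ᶠ[codiscrete ℂ] 0 from hf) a
    rwa [smul_zero] at this

lemma mem_nullMer {f : ℂ → ℂ} : f ∈ nullMer ↔ MerEq f 0 := Iff.rfl

lemma sub_mem_nullMer {f g : ℂ → ℂ} : f - g ∈ nullMer ↔ MerEq f g := by
  rw [mem_nullMer]
  exact eventuallyEq_iff_sub.symm

lemma mul_mem_nullMer (g : ℂ → ℂ) {f : ℂ → ℂ} (hf : f ∈ nullMer) : g * f ∈ nullMer := by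
  have : f =ᶠ[codiscrete ℂ] 0 := hf
  filter_upwards [this] with z hz
  simp [hz]

lemma shiftEnd_mem_nullMer (c : ℂ) {f : ℂ → ℂ} (hf : f ∈ nullMer) : shiftEnd c f ∈ nullMer :=
  MerEq.comp_add_const hf c

/-- The meromorphic functions in the plane. -/
def merSubmodule : Submodule ℂ (ℂ → ℂ) where
  carrier := {f | Meromorphic f}
  zero_mem' := Meromorphic.const 0
  add_mem' hf hg := hf.add hg
  smul_mem' a _ hf := (Meromorphic.const a).smul hf

lemma shiftEnd_mem_merSubmodule (c : ℂ) {f : ℂ → ℂ} (hf : f ∈ merSubmodule) :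
    shiftEnd c f ∈ merSubmodule :=
  Meromorphic.meromorphic_fun_comp_add_const_iff_meromorphic.2 hf

/-- Used with `nullMer` and `merSubmodule`, this lets polynomials in the translation operator act on
meromorphic functions modulo null functions without forming a quotient space. -/
lemma aeval_mem_of_mapsTo {M : Type*} [AddCommGroup M] [Module ℂ M] {T : Module.End ℂ M}
    {W : Submodule ℂ M} (hT : ∀ x ∈ W, T x ∈ W) (p : Polynomial ℂ) {x : M} (hx : x ∈ W) :
    Polynomial.aeval T p x ∈ W := by
  induction p using Polynomial.induction_on generalizing x with
  | C a => simpa [Module.algebraMap_end_apply] using W.smul_mem a hx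
  | add p q hp hq => simpa using W.add_mem (hp hx) (hq hx)
  | monomial n a h =>
    rw [pow_succ, ← mul_assoc, map_mul, Polynomial.aeval_X, Module.End.mul_apply]
    exact h (hT x hx)

/-! ### Linear difference equations with constant coefficients -/

lemma mem_periodicMer_iff {c : ℂ} {f : ℂ → ℂ} :
    f ∈ periodicMer c ↔ f ∈ merSubmodule ∧ (shiftEnd c - 1) f ∈ nullMer := by
  rw [LinearMap.sub_apply, Module.End.one_apply, sub_mem_nullMer]
  rfl

lemma periodicMer_congr {c : ℂ} {f g : ℂ → ℂ} (hf : f ∈ periodicMer c) (h : MerEq f g) :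
    g ∈ periodicMer c :=
  ⟨hf.1.congr_codiscrete h,
    ((MerEq.comp_add_const (EventuallyEq.symm h) c).trans hf.2).trans h⟩

lemma sum_mem_periodicMer {c : ℂ} {ι : Type*} {s : Finset ι} {π : ι → ℂ → ℂ}
    (h : ∀ i ∈ s, π i ∈ periodicMer c) : ∑ i ∈ s, π i ∈ periodicMer c := by
  rw [mem_periodicMer_iff, map_sum]
  exact ⟨Submodule.sum_mem _ fun i hi => (mem_periodicMer_iff.1 (h i hi)).1,
    Submodule.sum_mem _ fun i hi => (mem_periodicMer_iff.1 (h i hi)).2⟩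

lemma smul_mem_periodicMer {c : ℂ} {f : ℂ → ℂ} (a : ℂ) (h : f ∈ periodicMer c) :
    a • f ∈ periodicMer c := by
  rw [mem_periodicMer_iff] at h ⊢
  rw [map_smul]
  exact ⟨Submodule.smul_mem _ _ h.1, Submodule.smul_mem _ _ h.2⟩

lemma pow_mem_nullMer {c : ℂ} (N : ℕ) {f : ℂ → ℂ} (hf : f ∈ nullMer) :
    ((shiftEnd c - 1) ^ N) f ∈ nullMer := by
  have := aeval_mem_of_mapsTo (fun x => shiftEnd_mem_nullMer c (f := x))
    ((Polynomial.X - 1) ^ N) hf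
  simpa using this

/-- Iterated differences of `q(z / c) p(z)` with periodic `p` only involve `q`. -/
lemma shiftEnd_sub_one_pow_mul {c : ℂ} (hc : c ≠ 0) {p : ℂ → ℂ}
    (hp : (shiftEnd c - 1) p ∈ nullMer) (N : ℕ) (q : ℂ → ℂ) :
    ((shiftEnd c - 1) ^ N) (fun z => q (z / c) * p z)
      - (fun z => (fwdDiff 1)^[N] q (z / c) * p z) ∈ nullMer := by
  induction N generalizing q with
  | zero => simp
  | succ N ih =>
    rw [pow_succ, Module.End.mul_apply, Function.iterate_succ_apply]
    -- Product rule for differences: the error is q(z/c + 1) times (E-1)p, which is null.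
    have h1 : (shiftEnd c - 1) (fun z => q (z / c) * p z)
        - (fun z => fwdDiff 1 q (z / c) * p z) ∈ nullMer := by
      have : (shiftEnd c - 1) (fun z => q (z / c) * p z)
          - (fun z => fwdDiff 1 q (z / c) * p z)
          = (fun z => q (z / c + 1)) * ((shiftEnd c - 1) p) := by
        funext z
        simp [fwdDiff, add_div, hc]
        ring
      rw [this]
      exact mul_mem_nullMer _ hp
    have h2 := add_mem (pow_mem_nullMer (c := c) N h1) (ih (fwdDiff 1 q))
    simpa using h2

/-- Solutions of `(E - 1)^N g = 0` are polynomials with periodic coefficients. -/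
lemma exists_periodic_of_unipotent {c : ℂ} (hc : c ≠ 0) (N : ℕ) {g : ℂ → ℂ}
    (hg : g ∈ merSubmodule) (h : ((shiftEnd c - 1) ^ N) g ∈ nullMer) :
    ∃ π : ℕ → ℂ → ℂ, (∀ m < N, π m ∈ periodicMer c) ∧
      MerEq g (fun z => ∑ m ∈ Finset.range N, z ^ m * π m z) := by
  induction N generalizing g with
  | zero => exact ⟨0, by simp, by simpa [Pi.zero_def] using mem_nullMer.1 h⟩
  | succ N ih =>
    set p : ℂ → ℂ := ((shiftEnd c - 1) ^ N) g with hp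
    have hp1 : (shiftEnd c - 1) p ∈ nullMer := by
      rw [pow_succ', Module.End.mul_apply] at h
      exact h
    have hp0 : p ∈ merSubmodule := by
      have := aeval_mem_of_mapsTo (fun x => shiftEnd_mem_merSubmodule c (f := x))
        ((Polynomial.X - 1) ^ N) hg
      simpa using this
    have hpp : p ∈ periodicMer c := mem_periodicMer_iff.2 ⟨hp0, hp1⟩
    have hN : (N.factorial : ℂ) ≠ 0 := by exact_mod_cast N.factorial_ne_zero
    -- The N-th difference of w^N is N!, so u/N! has the same N-th difference p as g modulo null
    -- functions. Subtracting it lowers the exponent to N.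
    set u : ℂ → ℂ := fun z => (z / c) ^ N * p z with hu
    have hu0 : u ∈ merSubmodule := by
      have h1 : Meromorphic fun z : ℂ => (z / c) ^ N :=
        fun z => AnalyticAt.meromorphicAt (by fun_prop)
      exact h1.mul hp0
    have hup : ((shiftEnd c - 1) ^ N) u - (N.factorial : ℂ) • p ∈ nullMer := by
      have := shiftEnd_sub_one_pow_mul hc hp1 N (fun w => w ^ N)
      rw [fwdDiff_iter_eq_factorial] at this
      exact this
    obtain ⟨π, hπ, he⟩ := ih (g := g - (N.factorial : ℂ)⁻¹ • u)
      (sub_mem hg (Submodule.smul_mem _ _ hu0)) (by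
        have := nullMer.smul_mem (-(N.factorial : ℂ)⁻¹) hup
        convert this using 1
        rw [map_sub, map_smul, ← hp, smul_sub, smul_smul]
        field_simp
        module)
    refine ⟨fun m => if m = N then ((N.factorial : ℂ)⁻¹ * (c ^ N)⁻¹) • p else π m, ?_, ?_⟩
    · intro m hm
      by_cases hmN : m = N
      · simpa [hmN] using smul_mem_periodicMer _ hpp
      · simpa [hmN] using hπ m (by omega)
    · have he' : g - (N.factorial : ℂ)⁻¹ • u =ᶠ[codiscrete ℂ]
        (fun z => ∑ m ∈ Finset.range N, z ^ m * π m z) := he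
      filter_upwards [he'] with z hz
      rw [Finset.sum_range_succ]
      have : ∑ m ∈ Finset.range N, z ^ m *
          (if m = N then ((N.factorial : ℂ)⁻¹ * (c ^ N)⁻¹) • p else π m) z
          = ∑ m ∈ Finset.range N, z ^ m * π m z := by
        refine Finset.sum_congr rfl fun m hm => ?_
        rw [if_neg (Finset.mem_range.1 hm).ne]
      rw [this, ← hz]
      simp [hu, div_pow]
      field_simp
      ring

lemma cpow_div_eq_exp {σ : ℂ} (hσ : σ ≠ 0) (c z : ℂ) :
    σ ^ (z / c) = Complex.exp (Complex.log σ * (z / c)) := Complex.cpow_def_of_ne_zero hσ _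

/-- Translation by c multiplies σ^(z/c) by exactly σ, so conjugation by this function carries E-σ to
σ(E-1). -/
lemma shiftEnd_sub_pow_mul_cpow {c σ : ℂ} (hc : c ≠ 0) (hσ : σ ≠ 0) (N : ℕ) (g : ℂ → ℂ) :
    ((shiftEnd c - algebraMap ℂ _ σ) ^ N) (fun z => σ ^ (z / c) * g z)
      = fun z => σ ^ N * σ ^ (z / c) * ((shiftEnd c - 1) ^ N) g z := by
  induction N generalizing g with
  | zero => simp
  | succ N ih =>
    have h1 : (shiftEnd c - algebraMap ℂ (Module.End ℂ (ℂ → ℂ)) σ) (fun z => σ ^ (z / c) * g z)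
        = σ • fun z => σ ^ (z / c) * ((shiftEnd c - 1) g) z := by
      funext z
      simp [Module.algebraMap_end_apply, add_div, hc, Complex.cpow_add _ _ hσ]
      ring
    rw [pow_succ, Module.End.mul_apply, h1, map_smul, ih]
    funext z
    simp [pow_succ]
    ring

/-- Solutions of `(E - σ)^N f = 0`. -/
lemma exists_periodic_of_generalized_eigen {c : ℂ} (hc : c ≠ 0) (σ : ℂ) (N : ℕ) {f : ℂ → ℂ}
    (hf : f ∈ merSubmodule) (h : ((shiftEnd c - algebraMap ℂ _ σ) ^ N) f ∈ nullMer) :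
    ∃ π : ℕ → ℂ → ℂ, (∀ m < N, π m ∈ periodicMer c) ∧
      MerEq f (fun z => (∑ m ∈ Finset.range N, z ^ m * π m z) * σ ^ (z / c)) := by
  -- For σ = 0 the hypothesis says that a translate of f is null, so f itself is null and zero
  -- coefficients suffice.
  by_cases hσ : σ = 0
  · subst hσ
    refine ⟨0, fun m _ => mem_periodicMer_iff.2 ⟨zero_mem _, by simp⟩, ?_⟩
    have h0 : MerEq ((shiftEnd c ^ N) f) 0 := by
      rw [map_zero, sub_zero] at h
      exact h
    have h1 := h0.comp_add_const (-(N * c))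
    simp only [shiftEnd_pow_apply] at h1
    simpa [MerEq, Pi.zero_def] using h1
  · have hne : ∀ z : ℂ, σ ^ (z / c) ≠ 0 := fun z => by
      rw [cpow_div_eq_exp hσ]; exact Complex.exp_ne_zero _
    have hfg : f = fun z => σ ^ (z / c) * ((σ ^ (z / c))⁻¹ * f z) := by
      funext z
      rw [mul_inv_cancel_left₀ (hne z)]
    have hg : (fun z => (σ ^ (z / c))⁻¹ * f z) ∈ merSubmodule := by
      have h1 : Meromorphic fun z : ℂ => (σ ^ (z / c))⁻¹ := by
        simp_rw [cpow_div_eq_exp hσ, ← Complex.exp_neg]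
        exact fun z => AnalyticAt.meromorphicAt (by fun_prop)
      exact h1.mul hf
    rw [hfg, shiftEnd_sub_pow_mul_cpow hc hσ] at h
    have h2 : ((shiftEnd c - 1) ^ N) (fun z => (σ ^ (z / c))⁻¹ * f z) ∈ nullMer := by
      have := mul_mem_nullMer (fun z => (σ ^ N * σ ^ (z / c))⁻¹) h
      convert this using 1
      funext z
      simp only [Pi.mul_apply]
      rw [inv_mul_cancel_left₀ (mul_ne_zero (pow_ne_zero _ hσ) (hne z))]
    obtain ⟨π, hπ, he⟩ := exists_periodic_of_unipotent hc N hg h2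
    refine ⟨π, hπ, ?_⟩
    filter_upwards [he] with z hz
    rw [← hz, mul_comm, mul_inv_cancel_left₀ (hne z)]

/-- This turns the difference equation into annihilation of f by a polynomial in the translation
operator. -/
lemma aeval_charPoly (n : ℕ) (a : ℕ → ℂ) (c : ℂ) (f : ℂ → ℂ) :
    Polynomial.aeval (shiftEnd c) (charPoly n a) f = linDiffOp n a c f - f := by
  funext z
  simp [charPoly, linDiffOp, LinearMap.sum_apply, Module.algebraMap_end_apply, shiftEnd_pow_apply]

lemma natDegree_charPoly {n : ℕ} (hn : 1 ≤ n) {a : ℕ → ℂ} (han : a n ≠ 0) :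
    (charPoly n a).natDegree = n := by
  have h1 : (∑ j ∈ Finset.range (n + 1), Polynomial.C (a j) * Polynomial.X ^ j).natDegree = n := by
    refine le_antisymm (Polynomial.natDegree_sum_le_of_forall_le _ _ fun j hj => ?_)
      (Polynomial.le_natDegree_of_ne_zero ?_)
    · exact (Polynomial.natDegree_C_mul_X_pow_le _ _).trans
        (Nat.lt_succ_iff.1 (Finset.mem_range.1 hj))
    · simpa [Polynomial.finsetSum_coeff, Polynomial.coeff_C_mul, Polynomial.coeff_X_pow] using han
  rw [charPoly, Polynomial.natDegree_sub_eq_left_of_natDegree_lt, h1]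
  rw [h1, Polynomial.natDegree_one]
  omega

lemma charPoly_eq_prod {n : ℕ} (hn : 1 ≤ n) {a : ℕ → ℂ} (han : a n ≠ 0) {q : ℕ} {s : Fin q → ℂ}
    {N : Fin q → ℕ} (hs : Function.Injective s)
    (hroot : ∀ w, (charPoly n a).IsRoot w ↔ ∃ k, s k = w)
    (hN : ∀ k, (charPoly n a).rootMultiplicity (s k) = N k) :
    charPoly n a = Polynomial.C (charPoly n a).leadingCoeff *
      ∏ k, (Polynomial.X - Polynomial.C (s k)) ^ N k := by
  have h0 : charPoly n a ≠ 0 := by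
    intro h
    have := natDegree_charPoly hn han
    rw [h, Polynomial.natDegree_zero] at this
    omega
  conv_lhs => rw [(IsAlgClosed.splits (charPoly n a)).eq_prod_roots]
  congr 1
  classical
  rw [Finset.prod_multiset_map_count]
  have : (charPoly n a).roots.toFinset = Finset.univ.image s := by
    ext w
    rw [Multiset.mem_toFinset, Polynomial.mem_roots h0, hroot]
    simp
  rw [this, Finset.prod_image (fun x _ y _ h => hs h)]
  refine Finset.prod_congr rfl fun k _ => ?_
  rw [Polynomial.count_roots, hN]

/-- Meromorphic solutions of a linear difference equation with constant coefficients, in terms of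
the roots of its characteristic polynomial. -/
theorem exists_periodic_of_linDiffOp_eq {n : ℕ} (hn : 1 ≤ n) {a : ℕ → ℂ} (han : a n ≠ 0) {c : ℂ}
    (hc : c ≠ 0) {f : ℂ → ℂ} (hf : Meromorphic f) (h : MerEq (linDiffOp n a c f) f)
    {q : ℕ} {s : Fin q → ℂ} {N : Fin q → ℕ} (hs : Function.Injective s)
    (hroot : ∀ w, (charPoly n a).IsRoot w ↔ ∃ k, s k = w)
    (hN : ∀ k, (charPoly n a).rootMultiplicity (s k) = N k) :
    ∃ π : Fin q → ℕ → ℂ → ℂ, (∀ k, ∀ m < N k, π k m ∈ periodicMer c) ∧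
      MerEq f (fun z =>
        ∑ k, (∑ m ∈ Finset.range (N k), z ^ m * π k m z) * s k ^ (z / c)) := by
  have hdeg := natDegree_charPoly hn han
  have hprod := charPoly_eq_prod hn han hs hroot hN
  set P : Fin q → Polynomial ℂ := fun k => (Polynomial.X - Polynomial.C (s k)) ^ N k with hP
  have hlead : (charPoly n a).leadingCoeff ≠ 0 := by
    rw [Polynomial.leadingCoeff_ne_zero]
    rintro h0
    rw [h0, Polynomial.natDegree_zero] at hdeg
    omega
  have hnull : Polynomial.aeval (shiftEnd c) (∏ k, P k) f ∈ nullMer := by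
    have h1 := sub_mem_nullMer.2 h
    rw [← aeval_charPoly, hprod, map_mul, Polynomial.aeval_C, Module.End.mul_apply,
      Module.algebraMap_end_apply] at h1
    exact (nullMer.smul_mem_iff hlead).1 h1
  have hne : Nonempty (Fin q) := by
    obtain ⟨w, hw⟩ := IsAlgClosed.exists_root (charPoly n a) (by
      rw [Polynomial.degree_eq_natDegree (Polynomial.leadingCoeff_ne_zero.1 hlead), hdeg]
      exact_mod_cast (by omega : n ≠ 0))
    exact ⟨((hroot w).1 hw).choose⟩
  classical
  have hcop : Pairwise (Function.onFun IsCoprime P) := fun i j hij =>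
    (Polynomial.pairwise_coprime_X_sub_C hs hij).pow
  -- Bézout: the products omitting one factor P_k generate the unit ideal. The resulting summands F
  -- k of f are the primary components.
  obtain ⟨μ, hμ⟩ := exists_sum_eq_one_iff_pairwise_coprime'.2 hcop
  set F : Fin q → ℂ → ℂ := fun k =>
    Polynomial.aeval (shiftEnd c) (μ k * ∏ j ∈ {k}ᶜ, P j) f with hF
  have hsum : f = ∑ k, F k := by
    simp only [hF]
    rw [← LinearMap.sum_apply, ← map_sum, hμ, map_one, Module.End.one_apply]
  have hFmer : ∀ k, F k ∈ merSubmodule := fun k =>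
    aeval_mem_of_mapsTo (fun x => shiftEnd_mem_merSubmodule c (f := x)) _ hf
  have hFnull : ∀ k, ((shiftEnd c - algebraMap ℂ _ (s k)) ^ N k) (F k) ∈ nullMer := fun k => by
    have h1 : (shiftEnd c - algebraMap ℂ (Module.End ℂ (ℂ → ℂ)) (s k)) ^ N k
        = Polynomial.aeval (shiftEnd c) (P k) := by simp [hP]
    rw [h1, ← Module.End.mul_apply, ← map_mul, mul_left_comm, ← Finset.prod_singleton P k,
      Finset.prod_mul_prod_compl, map_mul, Module.End.mul_apply]
    exact aeval_mem_of_mapsTo (fun x => shiftEnd_mem_nullMer c (f := x)) _ hnull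
  choose π hπ he using fun k =>
    exists_periodic_of_generalized_eigen hc (s k) (N k) (hFmer k) (hFnull k)
  refine ⟨π, hπ, ?_⟩
  have he' : ∀ᶠ z in codiscrete ℂ, ∀ k, F k z =
      (∑ m ∈ Finset.range (N k), z ^ m * π k m z) * s k ^ (z / c) := eventually_all.2 he
  filter_upwards [he'] with z hz
  rw [hsum, Finset.sum_apply]
  exact Finset.sum_congr rfl fun k _ => hz k

/-- The case of simple roots. -/
theorem exists_periodic_of_linDiffOp_eq_of_injective {n : ℕ} (hn : 1 ≤ n) {a : ℕ → ℂ}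
    (han : a n ≠ 0) {c : ℂ} (hc : c ≠ 0) {f : ℂ → ℂ} (hf : Meromorphic f)
    (h : MerEq (linDiffOp n a c f) f) {ρ : Fin n → ℂ} (hρ : Function.Injective ρ)
    (hroot : ∀ j, (charPoly n a).IsRoot (ρ j)) :
    ∃ π : Fin n → ℂ → ℂ, (∀ j, π j ∈ periodicMer c) ∧
      MerEq f (fun z => ∑ j, ρ j ^ (z / c) * π j z) := by
  classical
  have hdeg := natDegree_charPoly hn han
  have h0 : charPoly n a ≠ 0 := by
    intro h
    rw [h, Polynomial.natDegree_zero] at hdeg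
    omega
  -- A polynomial of degree n has at most n roots with multiplicity, so n distinct ones exhaust them
  -- and all are simple.
  have hval : Finset.univ.val.map ρ = (charPoly n a).roots := by
    refine Multiset.eq_of_le_of_card_le ?_ ?_
    · refine (Multiset.le_iff_subset (Multiset.Nodup.map hρ Finset.univ.nodup)).2 fun w hw => ?_
      obtain ⟨j, -, rfl⟩ := Multiset.mem_map.1 hw
      exact (Polynomial.mem_roots h0).2 (hroot j)
    · simpa [hdeg] using (charPoly n a).card_roots'
  obtain ⟨π, hπ, he⟩ := exists_periodic_of_linDiffOp_eq hn han hc hf h (N := fun _ => 1) hρ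
    (fun w => by
      rw [← Polynomial.mem_roots h0, ← hval]
      simp)
    (fun k => by
      rw [← Polynomial.count_roots, ← hval]
      exact Multiset.count_eq_one_of_mem (Multiset.Nodup.map hρ Finset.univ.nodup)
        (Multiset.mem_map_of_mem ρ (Finset.mem_univ_val k)))
  refine ⟨fun j => π j 0, fun j => hπ j 0 one_pos, ?_⟩
  convert he using 3
  simp [mul_comm]

/-- If all roots are `0` or `1`, the solution is periodic. -/
lemma mem_periodicMer_of_roots_zero_one {n : ℕ} {c : ℂ} (hc : c ≠ 0) {f : ℂ → ℂ} {ρ : Fin n → ℂ}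
    (h01 : ∀ j, ρ j = 0 ∨ ρ j = 1) {π : Fin n → ℂ → ℂ} (hπ : ∀ j, π j ∈ periodicMer c)
    (he : MerEq f (fun z => ∑ j, ρ j ^ (z / c) * π j z)) : f ∈ periodicMer c := by
  refine periodicMer_congr (f := ∑ j, ρ j • π j)
    (sum_mem_periodicMer fun j _ => smul_mem_periodicMer _ (hπ j)) ?_
  refine EventuallyEq.trans ?_ he.symm
  -- In Lean `0 ^ (0 : ℂ) = 1`, so the point z = 0 must be discarded when a root is 0.
  have h0 : ∀ᶠ z : ℂ in codiscrete ℂ, z ≠ 0 := compl_singleton_mem_codiscreteWithin 0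
  filter_upwards [h0] with z hz
  rw [Finset.sum_apply]
  refine Finset.sum_congr rfl fun j _ => ?_
  rcases h01 j with h | h <;> simp [h, hz, hc]

/-! ### Growth of the characteristic function under translation -/

/-- The weight of a point of modulus `t` in the difference of the values of a logarithmic counting
function at `r` and at `s`. -/
def countingWeight (s r t : ℝ) : ℝ := if t ≤ r then Real.log r - Real.log (max s t) else 0

lemma countingWeight_nonneg {s r : ℝ} (hs : 0 < s) (hr : s ≤ r) (t : ℝ) :
    0 ≤ countingWeight s r t := by
  unfold countingWeight
  split_ifs with h
  · exact sub_nonneg.2 (Real.log_le_log (lt_max_of_lt_left hs) (max_le hr h))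
  · exact le_rfl

/-- With u = max 1 t the point is log(r/u) ≤ (1+a) log((r+a)/(u+a)). By Bernoulli with exponent 1+a,
the (1+a)-th power of (r+a)/(u+a) is at least 1 + (1+a)(r-u)/(u+a). This is at least r/u because
(1+a)u ≥ u+a, which is where u ≥ 1 enters. -/
lemma countingWeight_le {r a t T : ℝ} (hr : 1 ≤ r) (ha : 0 ≤ a) (hT : T ≤ t + a) :
    countingWeight 1 r t ≤ (1 + a) * countingWeight (1 + a) (r + a) T := by
  by_cases ht : t ≤ r
  · have hu0 : (1 : ℝ) ≤ max 1 t := le_max_left _ _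
    have hur : max 1 t ≤ r := max_le hr ht
    have hmax : max (1 + a) T ≤ max 1 t + a :=
      max_le (by linarith) (hT.trans (by linarith [le_max_right 1 t]))
    rw [countingWeight, countingWeight, if_pos ht, if_pos (by linarith)]
    generalize max 1 t = u at *
    have h1 : Real.log (max (1 + a) T) ≤ Real.log (u + a) :=
      Real.log_le_log (lt_max_of_lt_left (by linarith)) hmax
    have h2 : Real.log r - Real.log u ≤ (1 + a) * (Real.log (r + a) - Real.log (u + a)) := by
      rw [← Real.log_div (by linarith) (by linarith), ← Real.log_div (by linarith) (by linarith),
        ← Real.log_rpow (div_pos (by linarith) (by linarith))]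
      refine Real.log_le_log (div_pos (by linarith) (by linarith)) ?_
      have h3 : (r + a) / (u + a) = 1 + (r - u) / (u + a) := by
        field_simp [(by linarith : u + a ≠ 0)]
        ring
      have h4 : 0 ≤ (r - u) / (u + a) := div_nonneg (by linarith) (by linarith)
      rw [h3]
      refine le_trans ?_ (one_add_mul_self_le_rpow_one_add (by linarith) (by linarith))
      have h5 : (r - u) / u ≤ (1 + a) * ((r - u) / (u + a)) := by
        rw [← mul_div_assoc, div_le_div_iff₀ (by linarith) (by linarith)]
        nlinarith [mul_nonneg ha (sub_nonneg.2 hu0), sub_nonneg.2 hur,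
          mul_nonneg (mul_nonneg ha (sub_nonneg.2 hu0)) (sub_nonneg.2 hur)]
      have h6 : r / u = 1 + (r - u) / u := by
        field_simp
        ring
      rw [h6]
      linarith
    exact h2.trans (mul_le_mul_of_nonneg_left (by linarith) (by linarith))
  · rw [countingWeight, if_neg ht]
    exact mul_nonneg (by linarith) (countingWeight_nonneg (by linarith) (by linarith) _)

section

open Function.locallyFinsuppWithin

lemma finite_support_mul_countingWeight (D : Function.locallyFinsupp ℂ ℤ) (s r : ℝ) (c : ℂ) :
    (Function.support fun z => (D z : ℝ) * countingWeight s r ‖z - c‖).Finite := by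
  refine ((toClosedBall (‖c‖ + r) D).finiteSupport (isCompact_closedBall 0 _)).subset ?_
  intro z hz
  rw [Function.mem_support] at hz ⊢
  have h1 : ‖z - c‖ ≤ r := by
    by_contra h
    exact hz (by simp [countingWeight, h])
  have h2 : ‖z‖ ≤ ‖c‖ + r := by
    calc ‖z‖ = ‖c + (z - c)‖ := by ring_nf
      _ ≤ _ := (norm_add_le _ _).trans (by linarith)
  rw [toClosedBall_eval_within D (by simpa using h2.trans (le_abs_self _))]
  intro h
  exact hz (by simp [h])

/-- Subtracting the value at a positive radius s removes the special role of the origin: its weight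
log r - log s fits the general formula, since max s 0 = s. -/
lemma logCounting_sub_logCounting (D : Function.locallyFinsupp ℂ ℤ) {s r : ℝ} (hs : 0 < s)
    (hr : s ≤ r) :
    logCounting D r - logCounting D s = ∑ᶠ z, (D z : ℝ) * countingWeight s r ‖z‖ := by
  classical
  have hr0 : 0 < r := hs.trans_le hr
  have hfin := (toClosedBall r D).finiteSupport (isCompact_closedBall 0 |r|)
  set S := hfin.toFinset with hS
  have hmem : ∀ z, z ∈ S ↔ ‖z‖ ≤ r ∧ D z ≠ 0 := by
    intro z
    rw [hS, Set.Finite.mem_toFinset, Function.mem_support]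
    by_cases hz : ‖z‖ ≤ r
    · rw [toClosedBall_eval_within D (by simpa [abs_of_pos hr0] using hz)]
      simp [hz]
    · rw [apply_eq_zero_of_notMem _ (by simpa [abs_of_pos hr0] using hz)]
      simp [hz]
  have h0 : (D 0 : ℝ) * Real.log r - D 0 * Real.log s
      = ∑ z ∈ S, if z = 0 then (D 0 : ℝ) * (Real.log r - Real.log s) else 0 := by
    rw [Finset.sum_ite_eq' S 0]
    split_ifs with h
    · ring
    · have : D 0 = 0 := by
        by_contra h'
        exact h ((hmem 0).2 ⟨by simpa using hr0.le, h'⟩)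
      simp [this]
  have hin : ∀ z, ‖z‖ ≤ s → toClosedBall s D z = D z := fun z hz =>
    toClosedBall_eval_within D (by simpa [abs_of_pos hs] using hz)
  have hout : ∀ z, ¬ ‖z‖ ≤ s → toClosedBall s D z = 0 := fun z hz =>
    apply_eq_zero_of_notMem _ (by simpa [abs_of_pos hs] using hz)
  have e1 : ∑ᶠ z, (toClosedBall r D z : ℝ) * Real.log (r * ‖z‖⁻¹)
      = ∑ z ∈ S, (toClosedBall r D z : ℝ) * Real.log (r * ‖z‖⁻¹) := by
    refine finsum_eq_sum_of_support_subset _ fun z hz => ?_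
    rw [hS, Set.Finite.coe_toFinset, Function.mem_support]
    intro h
    exact hz (by simp [h])
  have e2 : ∑ᶠ z, (toClosedBall s D z : ℝ) * Real.log (s * ‖z‖⁻¹)
      = ∑ z ∈ S, (toClosedBall s D z : ℝ) * Real.log (s * ‖z‖⁻¹) := by
    refine finsum_eq_sum_of_support_subset _ fun z hz => ?_
    rw [Finset.mem_coe, hmem]
    have h1 : ‖z‖ ≤ s := by
      by_contra h
      exact hz (by simp [hout z h])
    refine ⟨h1.trans hr, fun h => hz ?_⟩
    simp [hin z h1, h]
  have e3 : ∑ᶠ z, (D z : ℝ) * countingWeight s r ‖z‖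
      = ∑ z ∈ S, (D z : ℝ) * countingWeight s r ‖z‖ := by
    refine finsum_eq_sum_of_support_subset _ fun z hz => ?_
    rw [Finset.mem_coe, hmem]
    constructor
    · by_contra h
      exact hz (by simp [countingWeight, h])
    · intro h
      exact hz (by simp [h])
  have e4 : logCounting D r - logCounting D s
      = (∑ᶠ z, (toClosedBall r D z : ℝ) * Real.log (r * ‖z‖⁻¹)
        - ∑ᶠ z, (toClosedBall s D z : ℝ) * Real.log (s * ‖z‖⁻¹))
        + ((D 0 : ℝ) * Real.log r - D 0 * Real.log s) := by
    simp only [logCounting, AddMonoidHom.coe_mk, ZeroHom.coe_mk]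
    ring
  rw [e4, e1, e2, e3, h0, ← Finset.sum_sub_distrib, ← Finset.sum_add_distrib]
  refine Finset.sum_congr rfl fun z hz => ?_
  have hzr := ((hmem z).1 hz).1
  rw [toClosedBall_eval_within D (by simpa [abs_of_pos hr0] using hzr), countingWeight,
    if_pos hzr]
  by_cases hz0 : z = 0
  · subst hz0
    simp [max_eq_left hs.le]
  · have hzn : ‖z‖ ≠ 0 := norm_ne_zero_iff.2 hz0
    rw [if_neg hz0, add_zero]
    by_cases hzs : ‖z‖ ≤ s
    · rw [hin z hzs, max_eq_left hzs, Real.log_mul hr0.ne' (inv_ne_zero hzn),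
        Real.log_mul hs.ne' (inv_ne_zero hzn)]
      ring
    · rw [hout z hzs, max_eq_right (not_le.1 hzs).le, Real.log_mul hr0.ne' (inv_ne_zero hzn),
        Real.log_inv]
      push_cast
      ring

/-- After the substitution z ↦ z - c both sides are sums over the same divisor. The weights compare
pointwise by ‖z‖ ≤ ‖z - c‖ + ‖c‖, and D ≥ 0 preserves the inequality. -/
lemma logCounting_translate_sub_le {D D' : Function.locallyFinsupp ℂ ℤ} (hD : 0 ≤ D) {c : ℂ}
    (hDD' : ∀ z, D' z = D (z + c)) {r : ℝ} (hr : 1 ≤ r) :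
    logCounting D' r - logCounting D' 1 ≤
      (1 + ‖c‖) * (logCounting D (r + ‖c‖) - logCounting D (1 + ‖c‖)) := by
  have hc := norm_nonneg c
  rw [logCounting_sub_logCounting D' one_pos hr,
    logCounting_sub_logCounting D (by linarith) (by linarith)]
  have e1 : ∑ᶠ z, (D' z : ℝ) * countingWeight 1 r ‖z‖
      = ∑ᶠ z, (D z : ℝ) * countingWeight 1 r ‖z - c‖ := by
    rw [← finsum_comp_equiv (Equiv.addRight c)
      (f := fun z => (D z : ℝ) * countingWeight 1 r ‖z - c‖)]
    simp [hDD']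
  rw [e1, mul_finsum]
  refine finsum_le_finsum' (finite_support_mul_countingWeight D 1 r c) ?_ fun z => ?_
  · refine (finite_support_mul_countingWeight D (1 + ‖c‖) (r + ‖c‖) 0).subset fun z hz => ?_
    rw [Function.mem_support] at hz ⊢
    intro h
    rw [sub_zero] at h
    exact hz (by simp [h])
  · have hz : (0 : ℝ) ≤ D z := by exact_mod_cast hD z
    calc (D z : ℝ) * countingWeight 1 r ‖z - c‖
        ≤ D z * ((1 + ‖c‖) * countingWeight (1 + ‖c‖) (r + ‖c‖) ‖z‖) := by
          refine mul_le_mul_of_nonneg_left (countingWeight_le hr hc ?_) hz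
          calc ‖z‖ = ‖(z - c) + c‖ := by ring_nf
            _ ≤ _ := norm_add_le _ _
      _ = _ := by ring

end

open ValueDistribution in
lemma valueDistribution_logCounting_translate_sub_le {f : ℂ → ℂ} (hf : Meromorphic f) (c a : ℂ)
    {r : ℝ} (hr : 1 ≤ r) :
    logCounting (fun z => f (z + c)) a r - logCounting (fun z => f (z + c)) a 1 ≤
      (1 + ‖c‖) * (logCounting f a (r + ‖c‖) - logCounting f a (1 + ‖c‖)) := by
  rw [logCounting_coe, logCounting_coe]
  refine logCounting_translate_sub_le (posPart_nonneg _) (fun z => ?_) hr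
  have h1 : MeromorphicOn (fun z => f z - a) Set.univ :=
    (hf.sub (Meromorphic.const a)).meromorphicOn
  have h2 : MeromorphicOn (fun z => f (z + c) - a) Set.univ :=
    ((Meromorphic.meromorphic_fun_comp_add_const_iff_meromorphic.2 hf).sub
      (Meromorphic.const a)).meromorphicOn
  have h3 : MeromorphicOn.divisor (fun z => f (z + c) - a) Set.univ z
      = MeromorphicOn.divisor (fun z => f z - a) Set.univ (z + c) := by
    rw [MeromorphicOn.divisor_apply h1 (Set.mem_univ _),
      MeromorphicOn.divisor_apply h2 (Set.mem_univ _)]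
    congr 1
    exact meromorphicOrderAt_comp_add_const_eq_meromorphicOrderAt (f := fun z => f z - a)
  simp [h3]

open ValueDistribution in
/-- Up to an additive constant, translating a meromorphic function changes its characteristic
function by a bounded factor and a bounded change of the radius. -/
theorem exists_characteristic_translate_le {f : ℂ → ℂ} (hf : Meromorphic f) (c : ℂ) :
    ∃ C, ∀ r ≥ 1, characteristic (fun z => f (z + c)) ⊤ r ≤
      (1 + ‖c‖) * characteristic f ⊤ (r + ‖c‖) + C := by
  have hc := norm_nonneg c
  have hg : Meromorphic fun z => f (z + c) :=
    Meromorphic.meromorphic_fun_comp_add_const_iff_meromorphic.2 hf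
  -- Cartan's formula: the characteristic is, up to a constant, the average of the counting
  -- functions of values on the unit circle. The proximity function thus needs no separate estimate.
  obtain ⟨A, hA⟩ := characteristic_top_eq_circleAverage_add_const hf
  obtain ⟨B, hB⟩ := characteristic_top_eq_circleAverage_add_const hg
  refine ⟨Real.circleAverage (logCounting (fun z => f (z + c)) · 1) 0 1
    - (1 + ‖c‖) * Real.circleAverage (logCounting f · (1 + ‖c‖)) 0 1 + B - (1 + ‖c‖) * A,
    fun r hr => ?_⟩
  rw [hA _ (by linarith), hB _ (by linarith)]
  have i1 := circleIntegrable_logCounting (R := r) hg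
  have i2 := circleIntegrable_logCounting (R := 1) hg
  have i3 := circleIntegrable_logCounting (R := r + ‖c‖) hf
  have i4 := circleIntegrable_logCounting (R := 1 + ‖c‖) hf
  have key := Real.circleAverage_mono (i1.sub i2) ((i3.sub i4).const_smul (a := 1 + ‖c‖))
    (fun a _ => by
      simpa using valueDistribution_logCounting_translate_sub_le hf c a hr)
  rw [Real.circleAverage_sub i1 i2, Real.circleAverage_smul, Real.circleAverage_sub i3 i4,
    smul_eq_mul] at key
  linarith

/-! ### Functions whose characteristic grows at most like a power -/

open ValueDistribution

/-- The characteristic function of `f` is `O(r ^ s)`. -/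
def CharGrowthLE (f : ℂ → ℂ) (s : ℝ) : Prop :=
  ∃ C, ∀ᶠ r in atTop, characteristic f ⊤ r ≤ C * r ^ s

lemma charGrowthLE_of_le_add {f : ℂ → ℂ} {s : ℝ} (hs : 0 ≤ s) {A B : ℝ}
    (h : ∀ᶠ r in atTop, characteristic f ⊤ r ≤ A * r ^ s + B) : CharGrowthLE f s := by
  refine ⟨A + |B|, ?_⟩
  filter_upwards [h, eventually_ge_atTop 1] with r hr h1
  have h2 : 1 ≤ r ^ s := Real.one_le_rpow h1 hs
  nlinarith [le_abs_self B, abs_nonneg B]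

lemma charGrowthLE_const (a : ℂ) {s : ℝ} (hs : 0 ≤ s) : CharGrowthLE (fun _ => a) s := by
  refine charGrowthLE_of_le_add hs (A := 0) (B := ‖a‖.posLog) (Eventually.of_forall fun r => ?_)
  simp [characteristic]

lemma CharGrowthLE.congr {f g : ℂ → ℂ} {s : ℝ} (hf : CharGrowthLE f s) (h : MerEq f g) :
    CharGrowthLE g s := by
  obtain ⟨C, hC⟩ := hf
  refine ⟨C, ?_⟩
  filter_upwards [hC, eventually_gt_atTop 0] with r hr h0
  rwa [← characteristic_congr_codiscrete h h0.ne']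

lemma CharGrowthLE.add {f g : ℂ → ℂ} {s : ℝ} (hs : 0 ≤ s) (mf : Meromorphic f)
    (mg : Meromorphic g) (hf : CharGrowthLE f s) (hg : CharGrowthLE g s) :
    CharGrowthLE (f + g) s := by
  obtain ⟨C, hC⟩ := hf
  obtain ⟨D, hD⟩ := hg
  refine charGrowthLE_of_le_add hs (A := C + D) (B := Real.log 2) ?_
  filter_upwards [hC, hD, eventually_ge_atTop 1] with r h1 h2 h3
  linarith [characteristic_add_top_le mf mg h3]

lemma CharGrowthLE.mul {f g : ℂ → ℂ} {s : ℝ} (mf : Meromorphic f) (mg : Meromorphic g)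
    (of : ∀ z, meromorphicOrderAt f z ≠ ⊤) (og : ∀ z, meromorphicOrderAt g z ≠ ⊤)
    (hf : CharGrowthLE f s) (hg : CharGrowthLE g s) : CharGrowthLE (f * g) s := by
  obtain ⟨C, hC⟩ := hf
  obtain ⟨D, hD⟩ := hg
  refine ⟨C + D, ?_⟩
  filter_upwards [hC, hD, eventually_ge_atTop 1] with r h1 h2 h3
  have := characteristic_mul_top_le h3 mf of mg og
  rw [Pi.add_apply] at this
  linarith

lemma CharGrowthLE.inv {f : ℂ → ℂ} {s : ℝ} (hs : 0 ≤ s) (mf : Meromorphic f)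
    (hf : CharGrowthLE f s) : CharGrowthLE f⁻¹ s := by
  obtain ⟨C, hC⟩ := hf
  refine charGrowthLE_of_le_add hs (A := C)
    (B := max |Real.log ‖f 0‖| |Real.log ‖meromorphicTrailingCoeffAt f 0‖|) ?_
  filter_upwards [hC] with r h1
  have := neg_le_of_abs_le (characteristic_sub_characteristic_inv_le mf (R := r))
  linarith

lemma CharGrowthLE.const_mul {f : ℂ → ℂ} {s : ℝ} (hs : 0 ≤ s) (a : ℂ) (mf : Meromorphic f)
    (of : ∀ z, meromorphicOrderAt f z ≠ ⊤) (hf : CharGrowthLE f s) :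
    CharGrowthLE (fun z => a * f z) s := by
  by_cases ha : a = 0
  · simpa [ha] using charGrowthLE_const 0 hs
  · refine CharGrowthLE.mul (Meromorphic.const a) mf (fun z => ?_) of (charGrowthLE_const a hs) hf
    rw [meromorphicOrderAt_const, if_neg ha]
    exact WithTop.zero_ne_top

lemma CharGrowthLE.comp_add_const {f : ℂ → ℂ} {s : ℝ} (hs : 0 ≤ s) (c : ℂ) (mf : Meromorphic f)
    (hf : CharGrowthLE f s) : CharGrowthLE (fun z => f (z + c)) s := by
  obtain ⟨C, hC⟩ := hf
  obtain ⟨B, hB⟩ := exists_characteristic_translate_le mf c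
  have hc := norm_nonneg c
  refine charGrowthLE_of_le_add hs (A := (1 + ‖c‖) * (max C 0 * (1 + ‖c‖) ^ s)) (B := B) ?_
  filter_upwards [(tendsto_atTop_add_const_right atTop ‖c‖ tendsto_id).eventually hC,
    eventually_ge_atTop 1] with r h1 h2
  refine (hB r h2).trans (add_le_add ?_ le_rfl)
  rw [mul_assoc, mul_assoc]
  refine mul_le_mul_of_nonneg_left (h1.trans ?_) (by linarith)
  have h3 : (r + ‖c‖) ^ s ≤ (1 + ‖c‖) ^ s * r ^ s := by
    rw [← Real.mul_rpow (by linarith) (by linarith)]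
    exact Real.rpow_le_rpow (by linarith) (by nlinarith) hs
  calc C * (r + ‖c‖) ^ s ≤ max C 0 * (r + ‖c‖) ^ s :=
        mul_le_mul_of_nonneg_right (le_max_left _ _) (Real.rpow_nonneg (by linarith) _)
    _ ≤ _ := mul_le_mul_of_nonneg_left h3 (le_max_right _ _)

lemma CharGrowthLE.finset_sum {ι : Type*} {t : Finset ι} {F : ι → ℂ → ℂ} {s : ℝ} (hs : 0 ≤ s)
    (mF : ∀ i ∈ t, Meromorphic (F i)) (hF : ∀ i ∈ t, CharGrowthLE (F i) s) :
    CharGrowthLE (∑ i ∈ t, F i) s := by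
  classical
  induction t using Finset.induction_on with
  | empty => simpa [Pi.zero_def] using charGrowthLE_const 0 hs
  | insert i t hi ih =>
    rw [Finset.sum_insert hi]
    have m : ∀ j ∈ t, Meromorphic (F j) := fun j hj => mF j (Finset.mem_insert_of_mem hj)
    exact CharGrowthLE.add hs (mF i (Finset.mem_insert_self i t)) (Meromorphic.sum m)
      (hF i (Finset.mem_insert_self i t))
      (ih m fun j hj => hF j (Finset.mem_insert_of_mem hj))

/-! ### Characteristic of exponentials of entire functions -/

lemma characteristic_exp_eq {g : ℂ → ℂ} (hg : Differentiable ℂ g) (r : ℝ) :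
    characteristic (fun z => Complex.exp (g z)) ⊤ r
      = Real.circleAverage (fun z => ‖Complex.exp (g z)‖.posLog) 0 r := by
  have han : AnalyticOn ℂ (fun z => Complex.exp (g z)) Set.univ :=
    fun z _ => (hg.cexp.analyticAt z).analyticWithinAt
  have h1 : logCounting (fun z => Complex.exp (g z)) ⊤ = 0 := by
    have := logCounting_add_analyticOn (Meromorphic.const (0 : ℂ)) han
    rw [logCounting_const] at this
    rw [← this]
    congr 1
    funext z
    simp
  rw [characteristic, h1, add_zero, proximity_top]

lemma circleIntegrable_posLog_norm_exp {g : ℂ → ℂ} (hg : Differentiable ℂ g) (r : ℝ) :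
    CircleIntegrable (fun z => ‖Complex.exp (g z)‖.posLog) 0 r := by
  have hm : Meromorphic fun z => Complex.exp (g z) :=
    fun z => (hg.cexp.analyticAt z).meromorphicAt
  exact hm.meromorphicOn.circleIntegrable_posLog_norm

lemma posLog_norm_exp (w : ℂ) : ‖Complex.exp w‖.posLog = max 0 w.re := by
  rw [Real.posLog, Complex.norm_exp, Real.log_exp]

lemma characteristic_exp_le {g : ℂ → ℂ} (hg : Differentiable ℂ g) {r M : ℝ}
    (h : ∀ z ∈ Metric.sphere (0 : ℂ) |r|, ‖g z‖ ≤ M) :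
    characteristic (fun z => Complex.exp (g z)) ⊤ r ≤ M := by
  rw [characteristic_exp_eq hg]
  refine Real.circleAverage_mono_on_of_le_circle (circleIntegrable_posLog_norm_exp hg r)
    fun z hz => ?_
  rw [posLog_norm_exp]
  exact max_le ((norm_nonneg _).trans (h z hz)) ((Complex.re_le_norm _).trans (h z hz))

lemma charGrowthLE_exp_polynomial (P : Polynomial ℂ) {d : ℕ} (hd : P.natDegree ≤ d) :
    CharGrowthLE (fun z => Complex.exp (P.eval z)) d := by
  refine ⟨∑ i ∈ Finset.range (d + 1), ‖P.coeff i‖, ?_⟩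
  filter_upwards [eventually_ge_atTop 1] with r hr
  refine characteristic_exp_le P.differentiable fun z hz => ?_
  have hz' : ‖z‖ = r := by
    rw [mem_sphere_zero_iff_norm] at hz
    rw [hz, abs_of_nonneg (by linarith)]
  rw [Polynomial.eval_eq_sum_range' (Nat.lt_succ_of_le hd), Real.rpow_natCast, Finset.sum_mul]
  refine (norm_sum_le _ _).trans (Finset.sum_le_sum fun i hi => ?_)
  rw [norm_mul, norm_pow, hz']
  exact mul_le_mul_of_nonneg_left
    (pow_le_pow_right₀ hr (Nat.lt_succ_iff.1 (Finset.mem_range.1 hi))) (norm_nonneg _)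

/-! ### Zero-free entire functions of finite order -/

/-- A primitive g of k'/k exists on the plane, and k e^(-g) has derivative zero; its constant value
is absorbed into g by a logarithm. -/
lemma exists_exp_eq_of_entire {k : ℂ → ℂ} (hk : Differentiable ℂ k) (h0 : ∀ z, k z ≠ 0) :
    ∃ g : ℂ → ℂ, Differentiable ℂ g ∧ ∀ z, k z = Complex.exp (g z) := by
  have hd : Differentiable ℂ (fun z => deriv k z / k z) :=
    Differentiable.div (fun z => (hk.analyticAt z).deriv.differentiableAt) hk h0
  obtain ⟨g, hg⟩ := hd.isExactOn_univ
  have hg' : ∀ z, HasDerivAt g (deriv k z / k z) z := fun z => hg z (Set.mem_univ z)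
  have hderiv : ∀ z, HasDerivAt (fun z => k z * Complex.exp (-g z)) 0 z := fun z => by
    have h1 := (hk z).hasDerivAt.mul (hg' z).neg.cexp
    have h2 : deriv k z * Complex.exp (-g z)
        + k z * (Complex.exp (-g z) * -(deriv k z / k z)) = 0 := by
      field_simp [h0 z]
      ring
    exact h2 ▸ h1
  have hconst : ∀ z, k z * Complex.exp (-g z) = k 0 * Complex.exp (-g 0) := fun z =>
    is_const_of_deriv_eq_zero (fun z => (hderiv z).differentiableAt) (fun z => (hderiv z).deriv) z 0
  have hne : k 0 * Complex.exp (-g 0) ≠ 0 := mul_ne_zero (h0 0) (Complex.exp_ne_zero _)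
  refine ⟨fun z => g z + Complex.log (k 0 * Complex.exp (-g 0)), ?_, fun z => ?_⟩
  · exact Differentiable.add_const _ fun z => (hg' z).differentiableAt
  · rw [Complex.exp_add, Complex.exp_log hne, ← hconst z, Complex.exp_neg, mul_left_comm,
      mul_inv_cancel₀ (Complex.exp_ne_zero _), mul_one]

/-- The real part of `g` inside a disc is controlled by the characteristic of `exp g`. -/
lemma re_le_three_mul_characteristic_exp {g : ℂ → ℂ} (hg : Differentiable ℂ g) {R : ℝ}
    (hR : 0 < R) {w : ℂ} (hw : ‖w‖ ≤ R / 2) :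
    (g w).re ≤ 3 * characteristic (fun z => Complex.exp (g z)) ⊤ R := by
  have hwb : w ∈ Metric.ball (0 : ℂ) R := by
    rw [mem_ball_zero_iff]
    linarith
  have hh : InnerProductSpace.HarmonicOnNhd (fun z => (g z).re) (Metric.closedBall 0 R) :=
    fun z _ => (hg.analyticAt z).harmonicAt_re
  have hcont : Continuous fun z => (g z).re := Complex.continuous_re.comp hg.continuous
  -- Poisson's formula: the kernel lies between 0 and (R+‖w‖)/(R-‖w‖) ≤ 3, and Re g is at most the
  -- positive logarithm of |e^g|.
  rw [← hh.circleAverage_re_herglotzRieszKernel_smul hwb, characteristic_exp_eq hg,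
    ← smul_eq_mul, ← Real.circleAverage_smul]
  refine Real.circleAverage_mono ?_ ?_ fun z hz => ?_
  · refine ContinuousOn.circleIntegrable' ?_
    exact (Complex.continuous_re.comp_continuousOn
      (continuousOn_herglotzRieszKernel_sphere hwb)).smul hcont.continuousOn
  · exact (circleIntegrable_posLog_norm_exp hg R).const_smul
  · rw [abs_of_pos hR] at hz
    have h1 := re_herglotzRieszKernel_le hz hwb
    have h2 := le_re_herglotzRieszKernel hz hwb
    have h3 : (R + ‖w - 0‖) / (R - ‖w - 0‖) ≤ 3 := by
      rw [sub_zero, div_le_iff₀ (by linarith)]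
      linarith
    have h4 : 0 ≤ (R - ‖w - 0‖) / (R + ‖w - 0‖) := by
      rw [sub_zero]
      exact div_nonneg (by linarith) (by linarith [norm_nonneg w])
    simp only [Pi.smul_apply', Function.comp_apply, smul_eq_mul, Pi.smul_apply]
    rw [posLog_norm_exp, herglotzRieszKernel_def]
    have h5 := le_max_right 0 (g z).re
    have h6 := le_max_left 0 (g z).re
    nlinarith

/-- The characteristic at 4r bounds Re g on the disc of radius 2r, and Borel–Carathéodory from 2r to
r gives |g| ≤ 2M + 3|g(0)|. Taking `max C 1` makes M positive. -/
lemma exists_norm_le_of_charGrowthLE_exp {g : ℂ → ℂ} (hg : Differentiable ℂ g) {s : ℝ}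
    (hs : 0 ≤ s) (h : CharGrowthLE (fun z => Complex.exp (g z)) s) :
    ∃ B, ∀ᶠ r in atTop, ∀ w, ‖w‖ = r → ‖g w‖ ≤ B * r ^ s := by
  obtain ⟨C, hC⟩ := h
  set A := max C 1 with hA
  refine ⟨2 * (3 * (A * 4 ^ s)) + 3 * ‖g 0‖, ?_⟩
  filter_upwards [(tendsto_id.const_mul_atTop (by norm_num : (0 : ℝ) < 4)).eventually hC,
    eventually_ge_atTop 1] with r hr h1 w hw
  simp only [id] at hr
  have hA1 : 1 ≤ A := le_max_right _ _
  have hr0 : 0 < r := by linarith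
  have hrs : 1 ≤ r ^ s := Real.one_le_rpow h1 hs
  have h4s : 0 < (4 : ℝ) ^ s := Real.rpow_pos_of_pos (by norm_num) _
  have hr' : characteristic (fun z => Complex.exp (g z)) ⊤ (4 * r) ≤ A * 4 ^ s * r ^ s := by
    refine hr.trans ?_
    rw [Real.mul_rpow (by norm_num) hr0.le, ← mul_assoc]
    have : 0 ≤ (4 : ℝ) ^ s * r ^ s := by positivity
    nlinarith [le_max_left C 1]
  have hM : 0 < 3 * (A * 4 ^ s * r ^ s) := by positivity
  have hmaps : Set.MapsTo g (Metric.ball 0 (2 * r)) {z | z.re ≤ 3 * (A * 4 ^ s * r ^ s)} := by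
    intro z hz
    rw [mem_ball_zero_iff] at hz
    have := re_le_three_mul_characteristic_exp hg (R := 4 * r) (by linarith) (w := z) (by linarith)
    exact this.trans (mul_le_mul_of_nonneg_left hr' (by norm_num))
  have hbc := Complex.borelCaratheodory hM hg.differentiableOn hmaps (by linarith)
    (z := w) (by rw [mem_ball_zero_iff]; linarith)
  rw [hw, show 2 * r - r = r by ring, show 2 * r + r = 3 * r by ring,
    mul_div_assoc _ r r, div_self hr0.ne', mul_div_assoc _ (3 * r) r,
    mul_div_assoc 3 r r, div_self hr0.ne'] at hbc
  nlinarith [norm_nonneg (g 0)]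

/-- An entire function of polynomial growth is a polynomial. -/
lemma exists_polynomial_of_norm_le {g : ℂ → ℂ} (hg : Differentiable ℂ g) {s : ℝ} (hs : 0 ≤ s)
    {B : ℝ} (h : ∀ᶠ r in atTop, ∀ w, ‖w‖ = r → ‖g w‖ ≤ B * r ^ s) :
    ∃ P : Polynomial ℂ, P.natDegree ≤ ⌊s⌋₊ ∧ ∀ z, g z = P.eval z := by
  -- Cauchy's estimates on circles of radius r → ∞ kill all Taylor coefficients of index above s.
  have hzero : ∀ n : ℕ, s < n → iteratedDeriv n g 0 = 0 := by
    intro n hn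
    have hlim : Tendsto (fun r : ℝ => n.factorial * B * r ^ (-(n - s))) atTop (nhds 0) := by
      simpa using (tendsto_rpow_neg_atTop (sub_pos.2 hn)).const_mul (n.factorial * B : ℝ)
    rw [← norm_le_zero_iff]
    refine ge_of_tendsto hlim ?_
    filter_upwards [h, eventually_gt_atTop 0] with r hr h0
    refine (Complex.norm_iteratedDeriv_le_of_forall_mem_sphere_norm_le n h0
      hg.diffContOnCl fun z hz => hr z (by simpa using hz)).trans (le_of_eq ?_)
    rw [neg_sub, Real.rpow_sub h0, Real.rpow_natCast]
    ring
  refine ⟨∑ i ∈ Finset.range (⌊s⌋₊ + 1),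
    Polynomial.C ((i.factorial : ℂ)⁻¹ * iteratedDeriv i g 0) * Polynomial.X ^ i, ?_, fun z => ?_⟩
  · refine Polynomial.natDegree_sum_le_of_forall_le _ _ fun i hi => ?_
    exact (Polynomial.natDegree_C_mul_X_pow_le _ _).trans
      (Nat.lt_succ_iff.1 (Finset.mem_range.1 hi))
  · have h1 := Complex.hasSum_taylorSeries_of_entire hg 0 z
    refine (h1.unique (hasSum_sum_of_ne_finset_zero (s := Finset.range (⌊s⌋₊ + 1))
      fun i hi => ?_)).trans ?_
    · rw [hzero i ?_, smul_zero, smul_zero]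
      rw [Finset.mem_range, not_lt] at hi
      exact (Nat.floor_lt hs).1 hi
    · rw [Polynomial.eval_finsetSum]
      refine Finset.sum_congr rfl fun i _ => ?_
      simp
      ring

/-- A meromorphic function without zeros and poles whose characteristic is `O(r ^ s)` is the
exponential of a polynomial of degree at most `s`. -/
theorem exists_exp_polynomial_of_order_eq_zero {h : ℂ → ℂ} (hh : Meromorphic h)
    (h0 : ∀ z, meromorphicOrderAt h z = 0) {s : ℝ} (hs : 0 ≤ s) (hg : CharGrowthLE h s) :
    ∃ P : Polynomial ℂ, P.natDegree ≤ ⌊s⌋₊ ∧ MerEq h (fun z => Complex.exp (P.eval z)) := by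
  set k := toMeromorphicNFOn h Set.univ with hk
  have hhk : MerEq h k := toMeromorphicNFOn_eqOn_codiscrete hh.meromorphicOn
  have hnf : ∀ z, MeromorphicNFAt k z :=
    fun z => meromorphicNFOn_toMeromorphicNFOn h Set.univ (Set.mem_univ z)
  have hk0 : ∀ z, meromorphicOrderAt k z = 0 := fun z => by
    rw [← h0 z]
    exact (meromorphicOrderAt_congr (merEq_iff.1 hhk z)).symm
  have hkd : Differentiable ℂ k := fun z =>
    ((hnf z).meromorphicOrderAt_nonneg_iff_analyticAt.1 (hk0 z).ge).differentiableAt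
  have hkne : ∀ z, k z ≠ 0 := fun z => (hnf z).meromorphicOrderAt_eq_zero_iff.1 (hk0 z)
  obtain ⟨g, hgd, hge⟩ := exists_exp_eq_of_entire hkd hkne
  have hkg : k = fun z => Complex.exp (g z) := funext hge
  obtain ⟨B, hB⟩ := exists_norm_le_of_charGrowthLE_exp hgd hs (hkg ▸ hg.congr hhk)
  obtain ⟨P, hP, hPe⟩ := exists_polynomial_of_norm_le hgd hs hB
  refine ⟨P, hP, ?_⟩
  rw [hkg] at hhk
  simpa only [hPe] using hhk

/-! ### Comparison with the order of growth -/

lemma charGrowthLE_of_growthOrder_lt {f : ℂ → ℂ} {s : ℝ} (h : growthOrder f < (s : EReal)) :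
    CharGrowthLE f s := by
  refine ⟨1, ?_⟩
  filter_upwards [eventually_lt_of_limsup_lt h, eventually_gt_atTop 1] with r hr h1
  rw [EReal.coe_lt_coe_iff, div_lt_iff₀ (Real.log_pos h1)] at hr
  rw [one_mul]
  -- A vanishing characteristic is treated apart, because `Real.log 0 = 0` carries no information.
  rcases (characteristic_nonneg (f := f) (a := ⊤) h1.le).eq_or_lt with h0 | h0
  · rw [← h0]
    positivity
  · rw [← Real.log_le_log_iff h0 (by positivity), Real.log_rpow (by linarith)]
    exact hr.le

lemma growthOrder_le_of_charGrowthLE {f : ℂ → ℂ} {s : ℝ} (hs : 0 ≤ s) (h : CharGrowthLE f s) :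
    growthOrder f ≤ (s : EReal) := by
  obtain ⟨C, hC⟩ := h
  set A := max C 1 with hA
  have hA1 : 1 ≤ A := le_max_right _ _
  have key : ∀ᶠ r in atTop, Real.log (characteristic f ⊤ r) / Real.log r
      ≤ s + Real.log A / Real.log r := by
    filter_upwards [hC, eventually_gt_atTop 1] with r hr h1
    have hl := Real.log_pos h1
    have hr0 : 0 < r := by linarith
    have hlA : 0 ≤ Real.log A := Real.log_nonneg hA1
    rw [div_le_iff₀ hl, add_mul, div_mul_cancel₀ _ hl.ne']
    rcases (characteristic_nonneg (f := f) (a := ⊤) h1.le).eq_or_lt with h0 | h0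
    · rw [← h0, Real.log_zero]
      positivity
    · have h2 : characteristic f ⊤ r ≤ A * r ^ s :=
        hr.trans (mul_le_mul_of_nonneg_right (le_max_left _ _) (by positivity))
      refine (Real.log_le_log h0 h2).trans (le_of_eq ?_)
      rw [Real.log_mul (by linarith) (by positivity), Real.log_rpow hr0]
      ring
  have hlim : Tendsto (fun r : ℝ => s + Real.log A / Real.log r) atTop (nhds s) := by
    simpa using (Real.tendsto_log_atTop.const_div_atTop (Real.log A)).const_add s
  refine EReal.le_of_forall_lt_iff_le.1 fun y hy => ?_
  rw [EReal.coe_lt_coe_iff] at hy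
  refine limsup_le_of_le (h := ?_)
  filter_upwards [key, hlim.eventually_lt_const hy] with r h1 h2
  exact EReal.coe_le_coe_iff.2 (h1.trans h2.le)

/-! ### Shared values -/

/-- Identity theorem: by connectedness of the plane, infinite order at one point propagates to every
point. -/
lemma meromorphicOrderAt_ne_top_of_not_merEq_zero {f : ℂ → ℂ} (hf : Meromorphic f)
    (h : ¬ MerEq f 0) (z : ℂ) : meromorphicOrderAt f z ≠ ⊤ := by
  intro hz
  refine h (merEq_iff.2 fun x => meromorphicOrderAt_eq_top_iff.1 ?_)
  by_contra hx
  exact hf.meromorphicOn.meromorphicOrderAt_ne_top_of_isPreconnected isPreconnected_univ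
    (Set.mem_univ x) (Set.mem_univ z) hx hz

lemma eventually_ne_zero_of_order_ne_top {f : ℂ → ℂ} (hf : Meromorphic f)
    (h : ∀ z, meromorphicOrderAt f z ≠ ⊤) : ∀ᶠ z in codiscrete ℂ, f z ≠ 0 :=
  hf.meromorphicOn.eventually_codiscreteWithin_apply_ne_zero fun z _ => h z

lemma IsTranscendentalMer.not_merEq_const {f : ℂ → ℂ} (hf : IsTranscendentalMer f) (v : ℂ) :
    ¬ MerEq f (fun _ => v) := fun h =>
  hf.2 ⟨Polynomial.C v, 1, one_ne_zero, by simpa using h⟩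

lemma IsTranscendentalMer.order_sub_const_ne_top {f : ℂ → ℂ} (hf : IsTranscendentalMer f)
    (v z : ℂ) : meromorphicOrderAt (fun w => f w - v) z ≠ ⊤ := by
  refine meromorphicOrderAt_ne_top_of_not_merEq_zero (hf.1.sub (Meromorphic.const v)) (fun h => ?_)
    z
  refine hf.not_merEq_const v ?_
  filter_upwards [h] with w hw
  exact sub_eq_zero.1 hw

lemma meromorphicOrderAt_const_nonneg (v z : ℂ) :
    0 ≤ meromorphicOrderAt (fun _ : ℂ => v) z := by
  rw [meromorphicOrderAt_const]
  split_ifs <;> simp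

lemma meromorphicOrderAt_sub_const_of_neg {f : ℂ → ℂ} (v : ℂ) {z : ℂ}
    (h : meromorphicOrderAt f z < 0) :
    meromorphicOrderAt (fun w => f w - v) z = meromorphicOrderAt f z := by
  have := meromorphicOrderAt_add_eq_left_of_lt (f₁ := f) (f₂ := fun _ => -v) (x := z)
    (MeromorphicAt.const _ _) (h.trans_le (meromorphicOrderAt_const_nonneg _ _))
  simpa [sub_eq_add_neg, Pi.add_def] using this

lemma meromorphicOrderAt_sub_const_nonneg {f : ℂ → ℂ} (hf : Meromorphic f) (v : ℂ) {z : ℂ}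
    (h : 0 ≤ meromorphicOrderAt f z) : 0 ≤ meromorphicOrderAt (fun w => f w - v) z := by
  have := meromorphicOrderAt_add (f₁ := f) (f₂ := fun _ => -v) (hf z) (MeromorphicAt.const _ _)
  have h2 := (le_min h (meromorphicOrderAt_const_nonneg (-v) z)).trans this
  simpa [sub_eq_add_neg, Pi.add_def] using h2

/-- Functions sharing a finite value and `∞` counting multiplicities have the same divisor after
subtraction of that value. -/
lemma meromorphicOrderAt_sub_eq_of_share {f g : ℂ → ℂ} (hf : Meromorphic f) (hg : Meromorphic g)
    {v : ℂ} (hv : ShareValueCM f g v) (hp : SharePolesCM f g) (z : ℂ) :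
    meromorphicOrderAt (fun w => f w - v) z = meromorphicOrderAt (fun w => g w - v) z := by
  have hpz := hp z
  have hvz := hv z
  simp only [negPoleMult] at hpz
  simp only [valueMult] at hvz
  -- At a pole, subtracting v does not change the order; elsewhere both orders are nonnegative, so
  -- truncation at 0 loses nothing.
  by_cases h : meromorphicOrderAt f z < 0
  · rw [min_eq_left h.le] at hpz
    have hg' : meromorphicOrderAt g z < 0 := by
      by_contra h'
      rw [min_eq_right (not_lt.1 h')] at hpz
      exact h.ne hpz
    rw [min_eq_left hg'.le] at hpz
    rw [meromorphicOrderAt_sub_const_of_neg v h, meromorphicOrderAt_sub_const_of_neg v hg',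
      hpz]
  · have hf' := not_lt.1 h
    rw [min_eq_right hf'] at hpz
    have hg' : 0 ≤ meromorphicOrderAt g z := min_eq_right_iff.1 hpz.symm
    rwa [max_eq_left (meromorphicOrderAt_sub_const_nonneg hf v hf'),
      max_eq_left (meromorphicOrderAt_sub_const_nonneg hg v hg')] at hvz

/-- If `F` and `f` share `v` and `∞` counting multiplicities, then `F - v = e ^ P (f - v)` for a
polynomial `P` whose degree is bounded by the growth of `f` and `F`. -/
lemma exists_exp_polynomial_of_share {f F : ℂ → ℂ} (hf : IsTranscendentalMer f)
    (hF : Meromorphic F) {s : ℝ} (hs : 0 ≤ s) (gf : CharGrowthLE f s) (gF : CharGrowthLE F s)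
    {v : ℂ} (hv : ShareValueCM F f v) (hp : SharePolesCM F f) :
    ∃ P : Polynomial ℂ, P.natDegree ≤ ⌊s⌋₊ ∧
      ∀ᶠ z in codiscrete ℂ, F z - v = Complex.exp (P.eval z) * (f z - v) := by
  have mf : Meromorphic fun z => f z - v := hf.1.sub (Meromorphic.const v)
  have mF : Meromorphic fun z => F z - v := hF.sub (Meromorphic.const v)
  have of := hf.order_sub_const_ne_top v
  have oeq := meromorphicOrderAt_sub_eq_of_share hF hf.1 hv hp
  have sub_growth : ∀ g : ℂ → ℂ, Meromorphic g → CharGrowthLE g s →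
      CharGrowthLE (fun z => g z - v) s := fun g mg hg => by
    have := CharGrowthLE.add hs mg (Meromorphic.const (-v)) hg (charGrowthLE_const (-v) hs)
    simpa [sub_eq_add_neg, Pi.add_def] using this
  have hord : ∀ z, meromorphicOrderAt ((fun z => F z - v) * (fun z => f z - v)⁻¹) z = 0 := by
    intro z
    rw [meromorphicOrderAt_mul (mF z) (mf z).inv, meromorphicOrderAt_inv, oeq z]
    obtain ⟨m, hm⟩ := WithTop.ne_top_iff_exists.1 (of z)
    rw [← hm]
    exact_mod_cast add_neg_cancel m
  have oinv : ∀ z, meromorphicOrderAt (fun z => f z - v)⁻¹ z ≠ ⊤ := by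
    intro z
    rw [meromorphicOrderAt_inv]
    obtain ⟨m, hm⟩ := WithTop.ne_top_iff_exists.1 (of z)
    rw [← hm]
    exact WithTop.coe_ne_top
  obtain ⟨P, hP, he⟩ := exists_exp_polynomial_of_order_eq_zero (mF.mul mf.inv) hord hs
    (CharGrowthLE.mul mF mf.inv (fun z => (oeq z).symm ▸ of z) oinv (sub_growth F hF gF)
      (CharGrowthLE.inv hs mf (sub_growth f hf.1 gf)))
  refine ⟨P, hP, ?_⟩
  filter_upwards [he, eventually_ne_zero_of_order_ne_top mf of] with z h1 h2
  rw [← h1]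
  simp [h2]

/-- A uniqueness theorem for functions of non-integral order. -/
theorem merEq_of_share_three_values {f F : ℂ → ℂ} (hf : IsTranscendentalMer f)
    (hF : Meromorphic F) {s : ℝ} (hs : 0 ≤ s) (gf : CharGrowthLE f s) (gF : CharGrowthLE F s)
    (hfloor : ⌊s⌋₊ = 0 ∨ ¬ CharGrowthLE f ⌊s⌋₊) {α β : ℂ} (hαβ : α ≠ β)
    (hα : ShareValueCM F f α) (hβ : ShareValueCM F f β) (hp : SharePolesCM F f) :
    MerEq F f := by
  obtain ⟨P, hP, hPe⟩ := exists_exp_polynomial_of_share hf hF hs gf gF hα hp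
  obtain ⟨Q, hQ, hQe⟩ := exists_exp_polynomial_of_share hf hF hs gf gF hβ hp
  set d := ⌊s⌋₊ with hd
  have dP : Differentiable ℂ fun z => Complex.exp (P.eval z) := P.differentiable.cexp
  have dQ : Differentiable ℂ fun z => Complex.exp (Q.eval z) := Q.differentiable.cexp
  have mer : ∀ {g : ℂ → ℂ}, Differentiable ℂ g → Meromorphic g :=
    fun hg z => (hg.analyticAt z).meromorphicAt
  set D : ℂ → ℂ := fun z => Complex.exp (P.eval z) - Complex.exp (Q.eval z) with hD
  set N : ℂ → ℂ :=
    fun z => β - α + α * Complex.exp (P.eval z) - β * Complex.exp (Q.eval z) with hN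
  have mD : Meromorphic D := mer (dP.sub dQ)
  have mN : Meromorphic N :=
    mer (((dP.const_mul α).const_add (β - α)).sub (dQ.const_mul β))
  -- The difference of the two relations F - α = e^P (f - α) and F - β = e^Q (f - β) eliminates F.
  have hDN : ∀ᶠ z in codiscrete ℂ, D z * f z = N z := by
    filter_upwards [hPe, hQe] with z h1 h2
    simp only [hD, hN]
    linear_combination h2 - h1
  by_cases hD0 : MerEq D 0
  · filter_upwards [hPe, hQe, hD0] with z h1 h2 h3
    have h4 : Complex.exp (P.eval z) = Complex.exp (Q.eval z) := sub_eq_zero.1 h3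
    rw [← h4] at h2
    have h5 : (β - α) * (Complex.exp (P.eval z) - 1) = 0 := by linear_combination h2 - h1
    have h6 : Complex.exp (P.eval z) = 1 :=
      sub_eq_zero.1 ((mul_eq_zero.1 h5).resolve_left (sub_ne_zero.2 hαβ.symm))
    rw [h6, one_mul] at h1
    exact sub_left_injective h1
  exfalso
  have oD := meromorphicOrderAt_ne_top_of_not_merEq_zero mD hD0
  have hfeq : MerEq (N * D⁻¹) f := by
    filter_upwards [hDN, eventually_ne_zero_of_order_ne_top mD oD] with z h1 h2
    rw [Pi.mul_apply, Pi.inv_apply, ← h1]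
    field_simp
  have oN : ∀ z, meromorphicOrderAt N z ≠ ⊤ := by
    refine meromorphicOrderAt_ne_top_of_not_merEq_zero mN fun hN0 => hf.not_merEq_const 0 ?_
    filter_upwards [hfeq, hN0] with z h1 h2
    rw [← h1, Pi.mul_apply, h2]
    simp
  have oinv : ∀ z, meromorphicOrderAt D⁻¹ z ≠ ⊤ := by
    intro z
    rw [meromorphicOrderAt_inv]
    obtain ⟨m, hm⟩ := WithTop.ne_top_iff_exists.1 (oD z)
    rw [← hm]
    exact WithTop.coe_ne_top
  have oexp : ∀ (R : Polynomial ℂ) (z : ℂ),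
      meromorphicOrderAt (fun z => Complex.exp (R.eval z)) z ≠ ⊤ := fun R => by
    refine meromorphicOrderAt_ne_top_of_not_merEq_zero (mer R.differentiable.cexp) fun h => ?_
    obtain ⟨z, hz⟩ := (merEq_iff.1 h 0).exists
    exact Complex.exp_ne_zero _ hz
  -- If the degree bound is 0, both exponentials are constant and so is f; otherwise N/D grows at
  -- most like r^d, which is excluded for f.
  rcases hfloor with h0 | hnot
  · rw [h0, Nat.le_zero] at hP hQ
    refine hf.not_merEq_const ((β - α + α * Complex.exp (P.coeff 0) - β * Complex.exp (Q.coeff 0))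
      * (Complex.exp (P.coeff 0) - Complex.exp (Q.coeff 0))⁻¹) (EventuallyEq.trans hfeq.symm ?_)
    refine Eventually.of_forall fun z => ?_
    simp only [Pi.mul_apply, Pi.inv_apply, hN, hD]
    rw [Polynomial.eq_C_of_natDegree_eq_zero hP, Polynomial.eq_C_of_natDegree_eq_zero hQ]
    simp
  · refine hnot (CharGrowthLE.congr ?_ hfeq)
    have hd0 : (0 : ℝ) ≤ d := Nat.cast_nonneg d
    have gP := charGrowthLE_exp_polynomial P hP
    have gQ := charGrowthLE_exp_polynomial Q hQ
    have cP := fun a => CharGrowthLE.const_mul hd0 a (mer dP) (oexp P) gP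
    have cQ := fun a => CharGrowthLE.const_mul hd0 a (mer dQ) (oexp Q) gQ
    have gD : CharGrowthLE D d := by
      have := CharGrowthLE.add hd0 (mer dP) (mer (dQ.const_mul (-1))) gP (cQ (-1))
      simpa [hD, Pi.add_def, sub_eq_add_neg] using this
    have gN : CharGrowthLE N d := by
      have h1 := CharGrowthLE.add hd0 (Meromorphic.const (β - α)) (mer (dP.const_mul α))
        (charGrowthLE_const (β - α) hd0) (cP α)
      have h2 := CharGrowthLE.add hd0 (mer ((dP.const_mul α).const_add (β - α)))
        (mer (dQ.const_mul (-β))) h1 (cQ (-β))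
      simpa [hN, Pi.add_def, sub_eq_add_neg] using h2
    exact CharGrowthLE.mul mN mD.inv oN oinv gN (CharGrowthLE.inv hd0 mD gD)

/-! ### Growth of the difference operator and choice of the exponent -/

lemma meromorphic_linDiffOp {n : ℕ} {a : ℕ → ℂ} {c : ℂ} {f : ℂ → ℂ} (hf : Meromorphic f) :
    Meromorphic (linDiffOp n a c f) :=
  Meromorphic.fun_sum fun j _ => (Meromorphic.const (a j)).mul
    (Meromorphic.meromorphic_fun_comp_add_const_iff_meromorphic.2 hf)

lemma charGrowthLE_linDiffOp {n : ℕ} {a : ℕ → ℂ} {c : ℂ} {f : ℂ → ℂ} (hf : IsTranscendentalMer f)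
    {s : ℝ} (hs : 0 ≤ s) (gf : CharGrowthLE f s) : CharGrowthLE (linDiffOp n a c f) s := by
  have hm : ∀ j : ℕ, Meromorphic fun z => f (z + j * c) := fun j =>
    Meromorphic.meromorphic_fun_comp_add_const_iff_meromorphic.2 hf.1
  have ho : ∀ (j : ℕ) (z : ℂ), meromorphicOrderAt (fun z => f (z + j * c)) z ≠ ⊤ := by
    intro j
    refine meromorphicOrderAt_ne_top_of_not_merEq_zero (hm j) fun h => hf.not_merEq_const 0 ?_
    simpa [MerEq, Pi.zero_def] using MerEq.comp_add_const h (-(j * c))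
  have := CharGrowthLE.finset_sum (t := Finset.range (n + 1))
    (F := fun j z => a j * f (z + j * c)) hs
    (fun j _ => (Meromorphic.const (a j)).mul (hm j))
    (fun j _ => CharGrowthLE.const_mul hs (a j) (hm j) (ho j)
      (CharGrowthLE.comp_add_const hs _ hf.1 gf))
  convert this using 1
  funext z
  simp [linDiffOp]

/-- For finite non-integral order there is a growth exponent whose integral part is not one, unless
that integral part is zero. -/
lemma exists_exponent_of_growthOrder {f : ℂ → ℂ} (hfin : growthOrder f ≠ ⊤)
    (hnonint : ∀ m : ℤ, growthOrder f ≠ ((m : ℝ) : EReal)) :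
    ∃ s : ℝ, 0 ≤ s ∧ CharGrowthLE f s ∧ (⌊s⌋₊ = 0 ∨ ¬ CharGrowthLE f ⌊s⌋₊) := by
  by_cases h1 : growthOrder f < ((1 : ℝ) : EReal)
  · obtain ⟨x, hx1, hx2⟩ := EReal.lt_iff_exists_real_btwn.1 h1
    -- The separating real x may be negative, while the exponent must be nonnegative.
    refine ⟨max x 0, le_max_right _ _, charGrowthLE_of_growthOrder_lt
      (hx1.trans_le (EReal.coe_le_coe_iff.2 (le_max_left _ _))), Or.inl ?_⟩
    rw [Nat.floor_eq_zero]
    exact max_lt (EReal.coe_lt_coe_iff.1 hx2) one_pos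
  · have hbot : growthOrder f ≠ ⊥ := fun h => h1 (by rw [h]; exact EReal.bot_lt_coe 1)
    set t := (growthOrder f).toReal with ht
    have hft : growthOrder f = (t : EReal) := (EReal.coe_toReal hfin hbot).symm
    have ht1 : 1 ≤ t := by
      rw [hft] at h1
      exact EReal.coe_le_coe_iff.1 (not_lt.1 h1)
    have hlt : (⌊t⌋₊ : ℝ) < t := by
      refine lt_of_le_of_ne (Nat.floor_le (by linarith)) fun h => ?_
      refine hnonint ⌊t⌋₊ ?_
      rw [hft, Int.cast_natCast, h]
    have hlt2 := Nat.lt_floor_add_one t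
    -- The midpoint of t and the next integer exceeds the order t but keeps its integral part, which
    -- is strictly below t.
    set s := (t + (⌊t⌋₊ + 1)) / 2 with hs
    have hfl : ⌊s⌋₊ = ⌊t⌋₊ := by
      rw [Nat.floor_eq_iff (by linarith)]
      constructor <;> linarith
    refine ⟨s, by linarith, charGrowthLE_of_growthOrder_lt ?_, Or.inr fun h => ?_⟩
    · rw [hft, EReal.coe_lt_coe_iff]
      linarith
    · rw [hfl] at h
      have := growthOrder_le_of_charGrowthLE (Nat.cast_nonneg _) h
      rw [hft, EReal.coe_le_coe_iff] at this
      linarith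

end

theorem mainTheorem2 (n : ℕ) (hn : 1 ≤ n) (a : ℕ → ℂ) (han : a n ≠ 0) (c : ℂ)
    (f : ℂ → ℂ) (hf : IsTranscendentalMer f)
    (hfin : growthOrder f ≠ ⊤)
    (hnonint : ∀ m : ℤ, growthOrder f ≠ ((m : ℝ) : EReal))
    (hper : ¬ MerEq (fun z => f (z + c)) f)
    (α β : ℂ) (hαβ : α ≠ β)
    (hα : ShareValueCM (linDiffOp n a c f) f α)
    (hβ : ShareValueCM (linDiffOp n a c f) f β)
    (hpoles : SharePolesCM (linDiffOp n a c f) f) :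
    MerEq (linDiffOp n a c f) f ∧
    -- the case of `n` distinct roots
    (∀ ρ : Fin n → ℂ, Function.Injective ρ → (∀ j, (charPoly n a).IsRoot (ρ j)) →
      (∃ π : Fin n → ℂ → ℂ, (∀ j, π j ∈ periodicMer c) ∧
        MerEq f (fun z => ∑ j, ρ j ^ (z / c) * π j z)) ∧
      ((∀ j, ρ j = 0 ∨ ρ j = 1) → (∃ j, ρ j ≠ 0) → f ∈ periodicMer c)) ∧
    -- the general case of roots `s k` with multiplicities `N k`
    (∀ (q : ℕ) (s : Fin q → ℂ) (N : Fin q → ℕ), Function.Injective s →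
      (∀ w, (charPoly n a).IsRoot w ↔ ∃ k, s k = w) →
      (∀ k, (charPoly n a).rootMultiplicity (s k) = N k) →
      ∃ π : Fin q → ℕ → ℂ → ℂ, (∀ k, ∀ m < N k, π k m ∈ periodicMer c) ∧
        MerEq f (fun z =>
          ∑ k, (∑ m ∈ Finset.range (N k), z ^ m * π k m z) * s k ^ (z / c))) := by
  have hc : c ≠ 0 := by
    rintro rfl
    exact hper (by simp [MerEq])
  obtain ⟨s, hs, gf, hfloor⟩ := exists_exponent_of_growthOrder hfin hnonint
  have heq : MerEq (linDiffOp n a c f) f :=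
    merEq_of_share_three_values hf (meromorphic_linDiffOp hf.1) hs gf
      (charGrowthLE_linDiffOp hf hs gf) hfloor hαβ hα hβ hpoles
  refine ⟨heq, fun ρ hρ hroot => ?_, fun q s N hs hroot hN =>
    exists_periodic_of_linDiffOp_eq hn han hc hf.1 heq hs hroot hN⟩
  obtain ⟨π, hπ, he⟩ := exists_periodic_of_linDiffOp_eq_of_injective hn han hc hf.1 heq hρ hroot
  exact ⟨⟨π, hπ, he⟩, fun h01 _ => mem_periodicMer_of_roots_zero_one hc h01 hπ he⟩
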